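/- **Theorem 4.1 (Strong Comparison Principle).** Let $N\ge 1$ and $0<\mu<N$. Let $f:[0,\infty)\to\mathbb R$ be continuous and monotone (nondecreasing, or nonincreasing) with $f(0)=0$, and let $F(s)=\int_0^s f(t)\,dt$. Let $\Gamma\subset\{x\in\mathbb R^N:x_1=0\}$ be compact. For $\lambda\in\mathbb R$ put $$\Sigma_\lambda=\{x\in\mathbb R^N:x_1<\lambda\},\qquad R_\lambda(x)=(2\lambda-x_1,x_2,\dots,x_N),\qquad \Sigma'_\lambda=\Sigma_\lambda\setminus R_\lambda(\Gamma),$$ and suppose that the open set $\Sigma'_\lambda$ is connected. Let $u:\mathbb R^N\to\mathbb R$ satisfy $u\ge 0$ on $\mathbb R^N\setminus\Gamma$, let $u_\lambda=u\circ R_\lambda$, and suppose that $u$ and $u_\lambda$ are continuous on $\Sigma'_\lambda$ and have weak gradients in $L^1_{\rm loc}(\Sigma'_\lambda)$. Suppose that the integrals $$v(x)=\int_{\mathbb R^N\setminus\Gamma}\frac{F(u(y))}{|x-y|^\mu}\,dy,\qquad v_\lambda(x)=\int_{\mathbb R^N\setminus R_\lambda(\Gamma)}\frac{F(u_\lambda(y))}{|x-y|^\mu}\,dy$$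 converge absolutely for almost every $x\in\Sigma'_\lambda$, that $v\,f(u)$ and $v_\lambda f(u_\lambda)$ belong to $L^1_{\rm loc}(\Sigma'_\lambda)$, and that for every nonnegative $\varphi\in C^1_c(\Sigma'_\lambda)$ $$\int_{\Sigma'_\lambda}\nabla u_\lambda\cdot\nabla\varphi\,dx-\int_{\Sigma'_\lambda}v_\lambda(x)f(u_\lambda(x))\varphi(x)\,dx\ \ge 0,\qquad \int_{\Sigma'_\lambda}\nabla u\cdot\nabla\varphi\,dx-\int_{\Sigma'_\lambda}v(x)f(u(x))\varphi(x)\,dx\ \le 0 .$$ If $u\le u_\lambda$ in $\Sigma'_\lambda$, then either $u\equiv u_\lambda$ in $\Sigma'_\lambda$ or $u<u_\lambda$ in $\Sigma'_\lambda$. -/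

import Mathlib

open MeasureTheory Set
open scoped ContDiff

namespace Hartree

noncomputable section

/-- The reflection `x ↦ (2 * lam - x₁, x₂, …, x_N)` across the hyperplane `{x₁ = lam}`.
The coordinate `x₁` of the usual notation is `x 0`. -/
def reflection {N : ℕ} [NeZero N] (lam : ℝ) (x : EuclideanSpace ℝ (Fin N)) :
    EuclideanSpace ℝ (Fin N) :=
  WithLp.toLp 2 (Function.update x.ofLp 0 (2 * lam - x 0))

/-- The open half space `{x₁ < lam}`. -/
def halfSpace (N : ℕ) [NeZero N] (lam : ℝ) : Set (EuclideanSpace ℝ (Fin N)) :=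
  {x | x 0 < lam}

/-- The half space `{x₁ < lam}` without the reflected singular set. -/
def puncturedHalfSpace {N : ℕ} [NeZero N] (lam : ℝ) (Γ : Set (EuclideanSpace ℝ (Fin N))) :
    Set (EuclideanSpace ℝ (Fin N)) :=
  halfSpace N lam \ (reflection lam '' Γ)

/-- The reflected function `u_lam (x) = u (x_lam)`. -/
def reflected {N : ℕ} [NeZero N] (lam : ℝ) (u : EuclideanSpace ℝ (Fin N) → ℝ) :
    EuclideanSpace ℝ (Fin N) → ℝ :=
  fun x => u (reflection lam x)

/-- The primitive `F` of `f` with `F 0 = 0`. -/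
def primitive (f : ℝ → ℝ) (s : ℝ) : ℝ := ∫ t in (0 : ℝ)..s, f t

/-- The integrand `y ↦ F (w y) / |x - y| ^ μ` of the nonlocal coefficient at the point `x`. -/
def potentialIntegrand {N : ℕ} (μ : ℝ) (f : ℝ → ℝ) (w : EuclideanSpace ℝ (Fin N) → ℝ)
    (x y : EuclideanSpace ℝ (Fin N)) : ℝ :=
  primitive f (w y) / ‖x - y‖ ^ μ

/-- The nonlocal coefficient `x ↦ ∫_{ℝ^N ∖ Z} F (w y) / |x - y| ^ μ dy`. -/
def potential {N : ℕ} (μ : ℝ) (f : ℝ → ℝ) (Z : Set (EuclideanSpace ℝ (Fin N)))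
    (w : EuclideanSpace ℝ (Fin N) → ℝ) (x : EuclideanSpace ℝ (Fin N)) : ℝ :=
  ∫ y in Zᶜ, potentialIntegrand μ f w x y

/-- `G` is the weak (distributional) gradient of `w` on the open set `Ω`. -/
structure IsWeakGradient {N : ℕ} (Ω : Set (EuclideanSpace ℝ (Fin N)))
    (w : EuclideanSpace ℝ (Fin N) → ℝ)
    (G : EuclideanSpace ℝ (Fin N) → EuclideanSpace ℝ (Fin N)) : Prop where
  locallyIntegrable : LocallyIntegrableOn w Ω
  locallyIntegrable_grad : LocallyIntegrableOn G Ω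
  integral_eq : ∀ φ : EuclideanSpace ℝ (Fin N) → ℝ,
    ContDiff ℝ ∞ φ → HasCompactSupport φ → tsupport φ ⊆ Ω →
      ∫ x in Ω, w x • gradient φ x = -∫ x in Ω, φ x • G x

/-- All terms in the weak form on `Ω` of `-Δ w = (∫_{ℝ^N ∖ Z} F (w y) / |x - y| ^ μ dy) f (w)`
are meaningful: `G` is the weak gradient of `w`, the nonlocal coefficient is given by a convergent
integral at almost every point of `Ω`, and the right-hand side is locally integrable on `Ω`. -/
structure WeakFormDefined {N : ℕ} (μ : ℝ) (f : ℝ → ℝ) (Z Ω : Set (EuclideanSpace ℝ (Fin N)))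
    (w : EuclideanSpace ℝ (Fin N) → ℝ)
    (G : EuclideanSpace ℝ (Fin N) → EuclideanSpace ℝ (Fin N)) : Prop where
  isWeakGradient : IsWeakGradient Ω w G
  integrable_potential : ∀ᵐ x ∂(volume.restrict Ω), IntegrableOn (potentialIntegrand μ f w x) Zᶜ
  locallyIntegrable_rhs : LocallyIntegrableOn (fun x => potential μ f Z w x * f (w x)) Ω

/-- The weak form `∫_Ω ∇w · ∇φ - ∫_Ω (∫_{ℝ^N ∖ Z} F (w y) / |x - y| ^ μ dy) f (w x) φ x dx`,
where `G` stands for the gradient of `w`. -/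
def weakForm {N : ℕ} (μ : ℝ) (f : ℝ → ℝ) (Z Ω : Set (EuclideanSpace ℝ (Fin N)))
    (w : EuclideanSpace ℝ (Fin N) → ℝ)
    (G : EuclideanSpace ℝ (Fin N) → EuclideanSpace ℝ (Fin N))
    (φ : EuclideanSpace ℝ (Fin N) → ℝ) : ℝ :=
  (∫ x in Ω, inner ℝ (G x) (gradient φ x)) - ∫ x in Ω, potential μ f Z w x * f (w x) * φ x

/-- `w` is a weak supersolution on `Ω` of the Hartree equation with singular set `Z`; the test
functions are the nonnegative functions in `C¹_c(Ω)`. -/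
def IsWeakSupersolution {N : ℕ} (μ : ℝ) (f : ℝ → ℝ) (Z Ω : Set (EuclideanSpace ℝ (Fin N)))
    (w : EuclideanSpace ℝ (Fin N) → ℝ) : Prop :=
  ∃ G : EuclideanSpace ℝ (Fin N) → EuclideanSpace ℝ (Fin N),
    WeakFormDefined μ f Z Ω w G ∧
      ∀ φ : EuclideanSpace ℝ (Fin N) → ℝ,
        ContDiff ℝ 1 φ → HasCompactSupport φ → tsupport φ ⊆ Ω → (∀ x, 0 ≤ φ x) →
          0 ≤ weakForm μ f Z Ω w G φ

/-- `w` is a weak subsolution on `Ω` of the Hartree equation with singular set `Z`; the test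
functions are the nonnegative functions in `C¹_c(Ω)`. -/
def IsWeakSubsolution {N : ℕ} (μ : ℝ) (f : ℝ → ℝ) (Z Ω : Set (EuclideanSpace ℝ (Fin N)))
    (w : EuclideanSpace ℝ (Fin N) → ℝ) : Prop :=
  ∃ G : EuclideanSpace ℝ (Fin N) → EuclideanSpace ℝ (Fin N),
    WeakFormDefined μ f Z Ω w G ∧
      ∀ φ : EuclideanSpace ℝ (Fin N) → ℝ,
        ContDiff ℝ 1 φ → HasCompactSupport φ → tsupport φ ⊆ Ω → (∀ x, 0 ≤ φ x) →
          weakForm μ f Z Ω w G φ ≤ 0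

end

end Hartree

/-!
Outside a null set, the points of `ℝ^N` come in pairs `y`, `R y` of reflections of each other with
`y` in the half space. For `x` in the half space, `y` is closer to `x` than `R y`, and passing from
`u` to `u_lam` exchanges the values of `F ∘ u` at `y` and `R y`. For nondecreasing `f` this moves
the larger value to the closer point, so that `v ≤ v_lam` and hence `v f(u) ≤ v_lam f(u_lam)`.
Therefore `u_lam - u` is superharmonic in the sense of distributions, nonnegative and continuous.

The strong minimum principle for such a function `w` needs no regularization: the integral of `w`
against the kernel `c ^ n * k (c ^ 2 * |x - x₀| ^ 2)` is nondecreasing in `c` when `-k` is the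
derivative of a bump profile `η`, because the derivative of the kernel in `c` is then a positive
multiple of `-Δ (η (c ^ 2 * |x - x₀| ^ 2))`. Letting `c → ∞` gives a mean value inequality at `x₀`,
so a zero of `w` spreads to a ball, and by connectedness to the whole domain.
-/

open Filter InnerProductSpace Module
open scoped Topology Laplacian

namespace Hartree

section MeasurePreserving

variable {E F : Type*} [NormedAddCommGroup E] [InnerProductSpace ℝ E] [FiniteDimensional ℝ E]
  [MeasurableSpace E] [BorelSpace E] [NormedAddCommGroup F] [InnerProductSpace ℝ F]
  [FiniteDimensional ℝ F] [MeasurableSpace F] [BorelSpace F]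

lemma measurePreserving_isometryEquiv (e : E ≃ᵢ F) : MeasurePreserving e := by
  have he : ⇑e = (fun x => x + e 0) ∘ e.toRealLinearIsometryEquiv := by
    funext x
    simp
  rw [he]
  exact (measurePreserving_add_right volume (e 0)).comp
    e.toRealLinearIsometryEquiv.measurePreserving

lemma integral_le_integral_of_add_comp_le {α : Type*} [MeasurableSpace α] {ν : Measure α}
    {R : α → α} (hR : MeasurePreserving R ν ν) (hRe : MeasurableEmbedding R) {g h : α → ℝ}
    (hg : Integrable g ν) (hh : Integrable h ν)
    (hgh : ∀ᵐ y ∂ν, g y + g (R y) ≤ h y + h (R y)) : ∫ y, g y ∂ν ≤ ∫ y, h y ∂ν := by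
  have hgR : Integrable (fun y => g (R y)) ν := (hR.integrable_comp_emb hRe).2 hg
  have hhR : Integrable (fun y => h (R y)) ν := (hR.integrable_comp_emb hRe).2 hh
  have key := integral_mono_ae (hg.add hgR) (hh.add hhR) hgh
  simp only [Pi.add_apply] at key
  rw [integral_add hg hgR, integral_add hh hhR, hR.integral_comp hRe, hR.integral_comp hRe] at key
  linarith

end MeasurePreserving

section Reflection

variable {N : ℕ} [NeZero N] {lam : ℝ}

lemma reflection_apply (x : EuclideanSpace ℝ (Fin N)) (i : Fin N) :
    reflection lam x i = if i = 0 then 2 * lam - x 0 else x i := by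
  simp [reflection, Function.update_apply]

lemma reflection_apply_zero (x : EuclideanSpace ℝ (Fin N)) :
    reflection lam x 0 = 2 * lam - x 0 := by
  simp [reflection_apply]

lemma reflection_eq_self {x : EuclideanSpace ℝ (Fin N)} (hx : x 0 = lam) :
    reflection lam x = x := by
  ext i
  by_cases hi : i = 0
  · subst hi
    rw [reflection_apply_zero]
    linarith
  · simp [reflection_apply, hi]

lemma involutive_reflection : Function.Involutive (reflection (N := N) lam) := by
  intro x
  ext i
  by_cases hi : i = 0
  · subst hi
    simp [reflection_apply]
  · simp [reflection_apply, hi]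

lemma image_reflection_eq_preimage (Γ : Set (EuclideanSpace ℝ (Fin N))) :
    reflection lam '' Γ = reflection lam ⁻¹' Γ :=
  congrFun (image_eq_preimage_of_inverse involutive_reflection involutive_reflection) Γ

lemma norm_sub_reflection_sq (x y : EuclideanSpace ℝ (Fin N)) :
    ‖x - reflection lam y‖ ^ 2 = ‖x - y‖ ^ 2 + 4 * ((lam - x 0) * (lam - y 0)) := by
  have key : ∑ i, ((x i - reflection lam y i) ^ 2 - (x i - y i) ^ 2)
      = 4 * ((lam - x 0) * (lam - y 0)) := by
    rw [Finset.sum_eq_single_of_mem 0 (Finset.mem_univ 0) fun i _ hi => by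
      simp [reflection_apply, hi], reflection_apply_zero]
    ring
  rw [Finset.sum_sub_distrib] at key
  simp only [EuclideanSpace.norm_sq_eq, Real.norm_eq_abs, sq_abs, PiLp.sub_apply]
  linarith

lemma norm_sub_le_norm_sub_reflection {x y : EuclideanSpace ℝ (Fin N)}
    (hx : x 0 ≤ lam) (hy : y 0 ≤ lam) : ‖x - y‖ ≤ ‖x - reflection lam y‖ := by
  refine le_of_sq_le_sq ?_ (norm_nonneg _)
  have := mul_nonneg (sub_nonneg.2 hx) (sub_nonneg.2 hy)
  rw [norm_sub_reflection_sq]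
  linarith

lemma isometry_reflection : Isometry (reflection (N := N) lam) := by
  refine Isometry.of_dist_eq fun x y => ?_
  rw [dist_eq_norm, dist_eq_norm, ← sq_eq_sq₀ (norm_nonneg _) (norm_nonneg _),
    norm_sub_reflection_sq, norm_sub_rev, norm_sub_reflection_sq, norm_sub_rev,
    reflection_apply_zero]
  ring

lemma measurePreserving_reflection : MeasurePreserving (reflection (N := N) lam) :=
  measurePreserving_isometryEquiv
    (IsometryEquiv.mk' (reflection lam) (reflection lam) involutive_reflection isometry_reflection)

lemma measurableEmbedding_reflection : MeasurableEmbedding (reflection (N := N) lam) :=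
  isometry_reflection.isClosedEmbedding.measurableEmbedding

lemma volume_image_reflection (Γ : Set (EuclideanSpace ℝ (Fin N))) :
    volume (reflection lam '' Γ) = volume Γ := by
  rw [image_reflection_eq_preimage]
  exact measurePreserving_reflection.measure_preimage_emb measurableEmbedding_reflection Γ

variable {Γ : Set (EuclideanSpace ℝ (Fin N))}

lemma volume_eq_zero_of_forall_apply_zero_eq_zero (hΓ : ∀ x ∈ Γ, x 0 = 0) : volume Γ = 0 := by
  let H : Submodule ℝ (EuclideanSpace ℝ (Fin N)) :=
    (EuclideanSpace.proj (0 : Fin N) : EuclideanSpace ℝ (Fin N) →L[ℝ] ℝ).ker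
  have hH : H ≠ ⊤ := fun h => by
    have : EuclideanSpace.single (0 : Fin N) (1 : ℝ) ∈ H := h ▸ Submodule.mem_top
    simp [H] at this
  exact measure_mono_null (fun x hx => by simpa [H] using hΓ x hx)
    (Measure.addHaar_submodule volume H hH)

lemma isOpen_puncturedHalfSpace (hΓ : IsClosed Γ) : IsOpen (puncturedHalfSpace lam Γ) := by
  have hopen : IsOpen (halfSpace N lam) := isOpen_lt (by fun_prop) continuous_const
  exact hopen.sdiff (isometry_reflection.isClosedEmbedding.isClosedMap Γ hΓ)

end Reflection

section Potential

variable {N : ℕ} {μ : ℝ} {f : ℝ → ℝ}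

lemma primitive_monotoneOn (hf0 : 0 ≤ f 0) (hfm : MonotoneOn f (Ici 0)) :
    MonotoneOn (primitive f) (Ici 0) := by
  intro a ha b hb hab
  have hint : ∀ c ∈ Ici (0 : ℝ), IntervalIntegrable f volume 0 c := fun c hc =>
    (hfm.mono ((uIcc_of_le hc).trans_subset Icc_subset_Ici_self)).intervalIntegrable
  have hpos : 0 ≤ ∫ t in a..b, f t := intervalIntegral.integral_nonneg hab fun t ht =>
    have ht0 : 0 ≤ t := (mem_Ici.1 ha).trans ht.1
    hf0.trans (hfm self_mem_Ici ht0 ht0)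
  rw [← sub_nonneg]
  exact hpos.trans_eq (intervalIntegral.integral_interval_sub_left (hint b hb) (hint a ha)).symm

lemma primitive_nonneg (hf0 : 0 ≤ f 0) (hfm : MonotoneOn f (Ici 0)) {s : ℝ} (hs : 0 ≤ s) :
    0 ≤ primitive f s := by
  have h : primitive f 0 ≤ primitive f s := primitive_monotoneOn hf0 hfm self_mem_Ici hs hs
  simpa [primitive] using h

lemma potentialIntegrand_neg (w : EuclideanSpace ℝ (Fin N) → ℝ) (x : EuclideanSpace ℝ (Fin N)) :
    potentialIntegrand μ (-f) w x = -potentialIntegrand μ f w x := by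
  funext y
  simp [potentialIntegrand, primitive, neg_div]

lemma potential_neg (Z : Set (EuclideanSpace ℝ (Fin N))) (w : EuclideanSpace ℝ (Fin N) → ℝ)
    (x : EuclideanSpace ℝ (Fin N)) : potential μ (-f) Z w x = -potential μ f Z w x := by
  simp [potential, potentialIntegrand_neg, integral_neg]

lemma potential_nonneg (hf0 : 0 ≤ f 0) (hfm : MonotoneOn f (Ici 0))
    {Z : Set (EuclideanSpace ℝ (Fin N))} (hZ : volume Z = 0)
    {w : EuclideanSpace ℝ (Fin N) → ℝ} (hw : ∀ x ∉ Z, 0 ≤ w x) (x : EuclideanSpace ℝ (Fin N)) :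
    0 ≤ potential μ f Z w x := by
  refine integral_nonneg_of_ae (ae_restrict_of_ae ?_)
  filter_upwards [measure_eq_zero_iff_ae_notMem.1 hZ] with y hy
  exact div_nonneg (primitive_nonneg hf0 hfm (hw y hy)) (by positivity)

variable [NeZero N] {lam : ℝ} {Γ : Set (EuclideanSpace ℝ (Fin N))}
  {u : EuclideanSpace ℝ (Fin N) → ℝ}

-- The difference of the two sides factors as
-- `(F (u (R y)) - F (u y)) * (|x - y| ^ (-μ) - |x - R y| ^ (-μ))`, where `R` is the reflection.
lemma potentialIntegrand_add_reflection_le (hμ : 0 ≤ μ) {x y : EuclideanSpace ℝ (Fin N)}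
    (hx : x 0 ≤ lam) (hy : y 0 ≤ lam) (hyx : y ≠ x)
    (hF : primitive f (u y) ≤ primitive f (reflected lam u y)) :
    potentialIntegrand μ f u x y + potentialIntegrand μ f u x (reflection lam y) ≤
      potentialIntegrand μ f (reflected lam u) x y +
        potentialIntegrand μ f (reflected lam u) x (reflection lam y) := by
  have hpos : 0 < ‖x - y‖ := norm_pos_iff.2 (sub_ne_zero.2 hyx.symm)
  have hker : (‖x - reflection lam y‖ ^ μ)⁻¹ ≤ (‖x - y‖ ^ μ)⁻¹ :=
    inv_anti₀ (by positivity)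
      (Real.rpow_le_rpow hpos.le (norm_sub_le_norm_sub_reflection hx hy) hμ)
  have hprod := mul_nonneg (sub_nonneg.2 hF) (sub_nonneg.2 hker)
  simp only [potentialIntegrand, reflected, involutive_reflection y, div_eq_mul_inv] at hprod ⊢
  linarith

lemma ae_potentialIntegrand_add_reflection_le (hμ : 0 ≤ μ) (hΓ : volume Γ = 0)
    (hF : ∀ y ∈ puncturedHalfSpace lam Γ, y ∉ Γ →
      primitive f (u y) ≤ primitive f (reflected lam u y))
    {x : EuclideanSpace ℝ (Fin N)} (hx : x 0 ≤ lam) :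
    ∀ᵐ y, potentialIntegrand μ f u x y + potentialIntegrand μ f u x (reflection lam y) ≤
      potentialIntegrand μ f (reflected lam u) x y +
        potentialIntegrand μ f (reflected lam u) x (reflection lam y) := by
  have hΓ' : volume (reflection lam '' Γ) = 0 := (volume_image_reflection Γ).trans hΓ
  filter_upwards [measure_eq_zero_iff_ae_notMem.1 hΓ, measure_eq_zero_iff_ae_notMem.1 hΓ',
    Measure.ae_ne volume x, Measure.ae_ne volume (reflection lam x)] with y hyΓ hyΓ' hyx hyx'
  rcases lt_trichotomy (y 0) lam with hy | hy | hy
  · exact potentialIntegrand_add_reflection_le hμ hx hy.le hyx (hF y ⟨hy, hyΓ'⟩ hyΓ)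
  · simp [potentialIntegrand, reflected, reflection_eq_self hy]
  · have hRy : reflection lam y 0 < lam := by
      rw [reflection_apply_zero]
      linarith
    have hRyΓ : reflection lam y ∉ Γ := by rwa [image_reflection_eq_preimage] at hyΓ'
    have hRyΓ' : reflection lam y ∉ reflection lam '' Γ := by
      rwa [involutive_reflection.injective.mem_set_image]
    have hRyx : reflection lam y ≠ x := fun h => hyx' (by rw [← h, involutive_reflection y])
    simpa only [involutive_reflection y, add_comm] using
      potentialIntegrand_add_reflection_le hμ hx hRy.le hRyx (hF _ ⟨hRy, hRyΓ'⟩ hRyΓ)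

lemma potential_le_potential_reflected (hμ : 0 ≤ μ) (hΓ : volume Γ = 0)
    (hF : ∀ y ∈ puncturedHalfSpace lam Γ, y ∉ Γ →
      primitive f (u y) ≤ primitive f (reflected lam u y))
    {x : EuclideanSpace ℝ (Fin N)} (hx : x 0 ≤ lam)
    (hu : IntegrableOn (potentialIntegrand μ f u x) Γᶜ)
    (hul : IntegrableOn (potentialIntegrand μ f (reflected lam u) x) (reflection lam '' Γ)ᶜ) :
    potential μ f Γ u x ≤ potential μ f (reflection lam '' Γ) (reflected lam u) x := by
  have restrict_compl {Z : Set (EuclideanSpace ℝ (Fin N))} (hZ : volume Z = 0) :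
      volume.restrict Zᶜ = volume :=
    Measure.restrict_eq_self_of_ae_mem (measure_eq_zero_iff_ae_notMem.1 hZ)
  have hΓ' : volume (reflection lam '' Γ) = 0 := (volume_image_reflection Γ).trans hΓ
  rw [IntegrableOn, restrict_compl hΓ] at hu
  rw [IntegrableOn, restrict_compl hΓ'] at hul
  rw [potential, potential, restrict_compl hΓ, restrict_compl hΓ']
  exact integral_le_integral_of_add_comp_le measurePreserving_reflection
    measurableEmbedding_reflection hu hul (ae_potentialIntegrand_add_reflection_le hμ hΓ hF hx)

lemma rhs_le_rhs_reflected_of_monotoneOn (hμ : 0 ≤ μ) (hf0 : 0 ≤ f 0)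
    (hfm : MonotoneOn f (Ici 0)) (hΓ : volume Γ = 0) (hu0 : ∀ x ∉ Γ, 0 ≤ u x)
    (hle : ∀ x ∈ puncturedHalfSpace lam Γ, u x ≤ reflected lam u x)
    {x : EuclideanSpace ℝ (Fin N)} (hx : x ∈ puncturedHalfSpace lam Γ) (hxΓ : x ∉ Γ)
    (hu : IntegrableOn (potentialIntegrand μ f u x) Γᶜ)
    (hul : IntegrableOn (potentialIntegrand μ f (reflected lam u) x) (reflection lam '' Γ)ᶜ) :
    potential μ f Γ u x * f (u x) ≤
      potential μ f (reflection lam '' Γ) (reflected lam u) x * f (reflected lam u x) := by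
  have hF : ∀ y ∈ puncturedHalfSpace lam Γ, y ∉ Γ →
      primitive f (u y) ≤ primitive f (reflected lam u y) := fun y hy hyΓ =>
    primitive_monotoneOn hf0 hfm (hu0 y hyΓ) ((hu0 y hyΓ).trans (hle y hy)) (hle y hy)
  have hux := hu0 x hxΓ
  have hfu : f (u x) ≤ f (reflected lam u x) := hfm hux (hux.trans (hle x hx)) (hle x hx)
  have hpot := potential_le_potential_reflected hμ hΓ hF hx.1.le hu hul
  exact mul_le_mul hpot hfu (hf0.trans (hfm self_mem_Ici hux hux))
    ((potential_nonneg hf0 hfm hΓ hu0 x).trans hpot)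

-- The products `v f(u)` and `v_lam f(u_lam)` are unchanged when `f`, and with it its primitive,
-- is replaced by `-f`.
lemma rhs_le_rhs_reflected (hμ : 0 ≤ μ) (hf0 : f 0 = 0)
    (hfm : MonotoneOn f (Ici 0) ∨ AntitoneOn f (Ici 0)) (hΓ : volume Γ = 0)
    (hu0 : ∀ x ∉ Γ, 0 ≤ u x)
    (hle : ∀ x ∈ puncturedHalfSpace lam Γ, u x ≤ reflected lam u x)
    {x : EuclideanSpace ℝ (Fin N)} (hx : x ∈ puncturedHalfSpace lam Γ) (hxΓ : x ∉ Γ)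
    (hu : IntegrableOn (potentialIntegrand μ f u x) Γᶜ)
    (hul : IntegrableOn (potentialIntegrand μ f (reflected lam u) x) (reflection lam '' Γ)ᶜ) :
    potential μ f Γ u x * f (u x) ≤
      potential μ f (reflection lam '' Γ) (reflected lam u) x * f (reflected lam u x) := by
  rcases hfm with hfm | hfm
  · exact rhs_le_rhs_reflected_of_monotoneOn hμ hf0.ge hfm hΓ hu0 hle hx hxΓ hu hul
  · have h := rhs_le_rhs_reflected_of_monotoneOn (f := -f) hμ (by simp [hf0]) hfm.neg hΓ hu0 hle
      hx hxΓ (by rw [potentialIntegrand_neg]; exact hu.neg)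
      (by rw [potentialIntegrand_neg]; exact hul.neg)
    simpa only [potential_neg, Pi.neg_apply, neg_mul_neg] using h

end Potential

section WeaklySuperharmonic

variable {E : Type*} [NormedAddCommGroup E] [InnerProductSpace ℝ E] [FiniteDimensional ℝ E]

lemma laplacian_eq_sum_fderiv_fderiv {ι : Type*} [Fintype ι] (b : OrthonormalBasis ι ℝ E)
    {φ : E → ℝ} (hφ : ContDiff ℝ 2 φ) (x : E) :
    Δ φ x = ∑ i, fderiv ℝ (fun y => fderiv ℝ φ y (b i)) x (b i) := by
  have hd : DifferentiableAt ℝ (fderiv ℝ φ) x :=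
    (hφ.fderiv_right (m := 1) (by norm_num)).differentiable one_ne_zero x
  rw [laplacian_eq_iteratedFDeriv_orthonormalBasis φ b]
  refine Finset.sum_congr rfl fun i _ => ?_
  rw [iteratedFDeriv_two_apply, fderiv_clm_apply hd (differentiableAt_const _)]
  simp

variable [MeasurableSpace E] [BorelSpace E]

/-- Superharmonicity in the sense of distributions: `-Δ w ≥ 0` on `Ω`, tested against nonnegative
smooth functions with compact support in `Ω`. -/
def IsWeaklySuperharmonicOn (w : E → ℝ) (Ω : Set E) : Prop :=
  ∀ φ : E → ℝ, ContDiff ℝ ∞ φ → HasCompactSupport φ → tsupport φ ⊆ Ω → (∀ x, 0 ≤ φ x) →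
    ∫ x in Ω, w x * Δ φ x ≤ 0

variable {F : Type*} [NormedAddCommGroup F] [NormedSpace ℝ F] {Ω : Set E}

lemma integrableOn_smul_left_of_tsupport_subset {H : E → F} (hΩ : IsOpen Ω)
    (hH : LocallyIntegrableOn H Ω) {φ : E → ℝ} (hφ : Continuous φ) (hc : HasCompactSupport φ)
    (hs : tsupport φ ⊆ Ω) : IntegrableOn (fun x => φ x • H x) Ω := by
  have hK : IntegrableOn (fun x => φ x • H x) (tsupport φ) :=
    (hH.integrableOn_compact_subset hs hc).continuousOn_smul hφ.continuousOn hc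
  refine hK.of_forall_sdiff_eq_zero hΩ.measurableSet fun x hx => ?_
  rw [image_eq_zero_of_notMem_tsupport hx.2, zero_smul]

lemma integrableOn_smul_right_of_tsupport_subset {w : E → ℝ} (hΩ : IsOpen Ω)
    (hw : LocallyIntegrableOn w Ω) {ψ : E → F} (hψ : Continuous ψ) (hc : HasCompactSupport ψ)
    (hs : tsupport ψ ⊆ Ω) : IntegrableOn (fun x => w x • ψ x) Ω := by
  have hK : IntegrableOn (fun x => w x • ψ x) (tsupport ψ) :=
    (hw.integrableOn_compact_subset hs hc).smul_continuousOn hψ.continuousOn hc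
  refine hK.of_forall_sdiff_eq_zero hΩ.measurableSet fun x hx => ?_
  rw [image_eq_zero_of_notMem_tsupport hx.2, smul_zero]

lemma integrableOn_mul_fderiv_apply {w : E → ℝ} (hΩ : IsOpen Ω) (hw : LocallyIntegrableOn w Ω)
    {φ : E → ℝ} (hφ : ContDiff ℝ 1 φ) (hc : HasCompactSupport φ) (hs : tsupport φ ⊆ Ω) (e : E) :
    IntegrableOn (fun x => w x * fderiv ℝ φ x e) Ω :=
  integrableOn_smul_right_of_tsupport_subset hΩ hw
    ((hφ.continuous_fderiv one_ne_zero).clm_apply continuous_const) (hc.fderiv_apply ℝ e)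
    ((tsupport_fderiv_apply_subset ℝ e).trans hs)

lemma integrableOn_mul_laplacian {w : E → ℝ} (hΩ : IsOpen Ω) (hw : LocallyIntegrableOn w Ω)
    {φ : E → ℝ} (hφ : ContDiff ℝ 2 φ) (hc : HasCompactSupport φ) (hs : tsupport φ ⊆ Ω) :
    IntegrableOn (fun x => w x * Δ φ x) Ω := by
  let b := stdOrthonormalBasis ℝ E
  simp only [laplacian_eq_sum_fderiv_fderiv b hφ, Finset.mul_sum]
  refine integrable_finsetSum _ fun i _ => integrableOn_mul_fderiv_apply hΩ hw ?_
    (hc.fderiv_apply ℝ (b i)) ((tsupport_fderiv_apply_subset ℝ (b i)).trans hs) (b i)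
  exact (hφ.fderiv_right (by norm_num)).clm_apply contDiff_const

end WeaklySuperharmonic

section WeakGradient

variable {N : ℕ} {Ω : Set (EuclideanSpace ℝ (Fin N))} {w : EuclideanSpace ℝ (Fin N) → ℝ}
  {G : EuclideanSpace ℝ (Fin N) → EuclideanSpace ℝ (Fin N)}

lemma IsWeakGradient.integral_mul_fderiv (hΩ : IsOpen Ω) (h : IsWeakGradient Ω w G)
    {φ : EuclideanSpace ℝ (Fin N) → ℝ} (hφ : ContDiff ℝ ∞ φ) (hc : HasCompactSupport φ)
    (hs : tsupport φ ⊆ Ω) (e : EuclideanSpace ℝ (Fin N)) :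
    ∫ x in Ω, w x * fderiv ℝ φ x e = -∫ x in Ω, φ x * inner ℝ e (G x) := by
  have hgrad : Continuous (gradient φ) :=
    (InnerProductSpace.toDual ℝ _).symm.continuous.comp (hφ.continuous_fderiv (by simp))
  have hint : IntegrableOn (fun x => w x • gradient φ x) Ω :=
    integrableOn_smul_right_of_tsupport_subset hΩ h.locallyIntegrable hgrad
      ((hc.fderiv ℝ).comp_left (map_zero _))
      ((tsupport_comp_subset (map_zero _) _).trans ((tsupport_fderiv_subset ℝ).trans hs))
  have h1 := congrArg (inner ℝ e) (h.integral_eq φ hφ hc hs)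
  rw [inner_neg_right, ← integral_inner hint,
    ← integral_inner (integrableOn_smul_left_of_tsupport_subset hΩ h.locallyIntegrable_grad
      hφ.continuous hc hs)] at h1
  simpa only [inner_smul_right, inner_gradient_right, conj_trivial, smul_eq_mul] using h1

lemma IsWeakGradient.integral_inner_gradient (hΩ : IsOpen Ω) (h : IsWeakGradient Ω w G)
    {φ : EuclideanSpace ℝ (Fin N) → ℝ} (hφ : ContDiff ℝ ∞ φ) (hc : HasCompactSupport φ)
    (hs : tsupport φ ⊆ Ω) :
    ∫ x in Ω, inner ℝ (G x) (gradient φ x) = -∫ x in Ω, w x * Δ φ x := by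
  let b := EuclideanSpace.basisFun (Fin N) ℝ
  have hd (i) : ContDiff ℝ ∞ fun x => fderiv ℝ φ x (b i) :=
    (hφ.fderiv_right (by simp)).clm_apply contDiff_const
  have hdc (i) : HasCompactSupport fun x => fderiv ℝ φ x (b i) := hc.fderiv_apply ℝ (b i)
  have hds (i) : tsupport (fun x => fderiv ℝ φ x (b i)) ⊆ Ω :=
    (tsupport_fderiv_apply_subset ℝ (b i)).trans hs
  have hinner (x) : inner ℝ (G x) (gradient φ x)
      = ∑ i, fderiv ℝ φ x (b i) * inner ℝ (b i) (G x) := by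
    rw [← b.sum_inner_mul_inner]
    refine Finset.sum_congr rfl fun i _ => ?_
    rw [inner_gradient_right, real_inner_comm, conj_trivial, mul_comm]
  have hlap (x) : w x * Δ φ x
      = ∑ i, w x * fderiv ℝ (fun y => fderiv ℝ φ y (b i)) x (b i) := by
    rw [laplacian_eq_sum_fderiv_fderiv b (hφ.of_le (by norm_cast)), Finset.mul_sum]
  have hinti (i) : IntegrableOn (fun x => fderiv ℝ φ x (b i) * inner ℝ (b i) (G x)) Ω := by
    simpa only [inner_smul_right, IntegrableOn] using
      (integrableOn_smul_left_of_tsupport_subset hΩ h.locallyIntegrable_grad (hd i).continuous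
      (hdc i) (hds i)).const_inner (𝕜 := ℝ) (b i)
  simp only [hinner, hlap]
  rw [integral_finsetSum _ fun i _ => hinti i, integral_finsetSum _ fun i _ =>
    integrableOn_mul_fderiv_apply hΩ h.locallyIntegrable ((hd i).of_le (by norm_cast)) (hdc i)
      (hds i) (b i), ← Finset.sum_neg_distrib]
  refine Finset.sum_congr rfl fun i _ => ?_
  rw [h.integral_mul_fderiv hΩ (hd i) (hdc i) (hds i), neg_neg]

lemma weakForm_eq (hΩ : IsOpen Ω) {μ : ℝ} {f : ℝ → ℝ} {Z : Set (EuclideanSpace ℝ (Fin N))}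
    (h : IsWeakGradient Ω w G)
    {φ : EuclideanSpace ℝ (Fin N) → ℝ} (hφ : ContDiff ℝ ∞ φ) (hc : HasCompactSupport φ)
    (hs : tsupport φ ⊆ Ω) :
    weakForm μ f Z Ω w G φ
      = -(∫ x in Ω, w x * Δ φ x) - ∫ x in Ω, φ x * (potential μ f Z w x * f (w x)) := by
  simp only [weakForm, h.integral_inner_gradient hΩ hφ hc hs, mul_comm (φ _)]

lemma isWeaklySuperharmonicOn_sub {μ : ℝ} {f : ℝ → ℝ} {Z₁ Z₂ : Set (EuclideanSpace ℝ (Fin N))}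
    {w₁ w₂ : EuclideanSpace ℝ (Fin N) → ℝ} (hΩ : IsOpen Ω)
    (h₁ : IsWeakSupersolution μ f Z₁ Ω w₁) (h₂ : IsWeakSubsolution μ f Z₂ Ω w₂)
    (hle : ∀ᵐ x ∂volume.restrict Ω,
      potential μ f Z₂ w₂ x * f (w₂ x) ≤ potential μ f Z₁ w₁ x * f (w₁ x)) :
    IsWeaklySuperharmonicOn (w₁ - w₂) Ω := by
  intro φ hφ hc hs hφ0
  obtain ⟨G₁, hG₁, h₁⟩ := h₁
  obtain ⟨G₂, hG₂, h₂⟩ := h₂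
  have hφ1 : ContDiff ℝ 1 φ := hφ.of_le (by norm_cast)
  have hw₁ := h₁ φ hφ1 hc hs hφ0
  have hw₂ := h₂ φ hφ1 hc hs hφ0
  rw [weakForm_eq hΩ hG₁.isWeakGradient hφ hc hs] at hw₁
  rw [weakForm_eq hΩ hG₂.isWeakGradient hφ hc hs] at hw₂
  have hrhs := integral_mono_ae
    (integrableOn_smul_left_of_tsupport_subset hΩ hG₂.locallyIntegrable_rhs hφ.continuous hc hs)
    (integrableOn_smul_left_of_tsupport_subset hΩ hG₁.locallyIntegrable_rhs hφ.continuous hc hs)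
    (hle.mono fun x hx => mul_le_mul_of_nonneg_left hx (hφ0 x))
  have hφ2 : ContDiff ℝ 2 φ := hφ.of_le (by norm_cast)
  simp only [Pi.sub_apply, sub_mul]
  rw [integral_sub (integrableOn_mul_laplacian hΩ hG₁.isWeakGradient.locallyIntegrable hφ2 hc hs)
    (integrableOn_mul_laplacian hΩ hG₂.isWeakGradient.locallyIntegrable hφ2 hc hs)]
  simp only [smul_eq_mul] at hrhs
  linarith

end WeakGradient

section RadialLaplacian

variable {E : Type*} [NormedAddCommGroup E] [InnerProductSpace ℝ E]

lemma hasFDerivAt_comp_norm_sub_sq {g : ℝ → ℝ} {g' : ℝ} {x₀ x : E}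
    (hg : HasDerivAt g g' (‖x - x₀‖ ^ 2)) :
    HasFDerivAt (fun y => g (‖y - x₀‖ ^ 2)) ((2 * g') • innerSL ℝ (x - x₀)) x := by
  refine (hg.comp_hasFDerivAt x ((hasFDerivAt_id x).sub_const x₀).norm_sq).congr_fderiv ?_
  ext y
  simp only [ContinuousLinearMap.comp_id, FunLike.coe_smul, Pi.smul_apply, innerSL_apply_apply,
    two_nsmul, FunLike.coe_add, Pi.add_apply, id_eq, smul_eq_mul]
  ring

lemma laplacian_comp_norm_sub_sq [FiniteDimensional ℝ E] {g : ℝ → ℝ} (hg : ContDiff ℝ 2 g)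
    (x₀ x : E) :
    Δ (fun y => g (‖y - x₀‖ ^ 2)) x = 2 * finrank ℝ E * deriv g (‖x - x₀‖ ^ 2)
      + 4 * ‖x - x₀‖ ^ 2 * deriv (deriv g) (‖x - x₀‖ ^ 2) := by
  let b := stdOrthonormalBasis ℝ E
  have hg1 (t : ℝ) : HasDerivAt g (deriv g t) t := (hg.differentiable two_ne_zero t).hasDerivAt
  have hg2 (t : ℝ) : HasDerivAt (deriv g) (deriv (deriv g) t) t :=
    (hg.differentiable_deriv_two t).hasDerivAt
  have hfst (y e : E) : fderiv ℝ (fun y => g (‖y - x₀‖ ^ 2)) y e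
      = 2 * deriv g (‖y - x₀‖ ^ 2) * inner ℝ (y - x₀) e := by
    rw [(hasFDerivAt_comp_norm_sub_sq (hg1 _)).fderiv, FunLike.coe_smul, Pi.smul_apply,
      innerSL_apply_apply, smul_eq_mul]
  have hsnd (e : E) (he : ‖e‖ = 1) :
      fderiv ℝ (fun y => 2 * deriv g (‖y - x₀‖ ^ 2) * inner ℝ (y - x₀) e) x e
        = 2 * deriv g (‖x - x₀‖ ^ 2)
          + 4 * deriv (deriv g) (‖x - x₀‖ ^ 2) * ‖inner ℝ (x - x₀) e‖ ^ 2 := by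
    have hinner : HasFDerivAt (fun y => inner ℝ (y - x₀) e) (innerSL ℝ e) x := by
      simp only [real_inner_comm e]
      exact ((innerSL ℝ e).hasFDerivAt.comp x ((hasFDerivAt_id x).sub_const x₀))
    have hprod : HasFDerivAt (fun y => 2 * deriv g (‖y - x₀‖ ^ 2) * inner ℝ (y - x₀) e) _ x :=
      ((hasFDerivAt_comp_norm_sub_sq (hg2 _)).const_mul 2).mul hinner
    rw [hprod.fderiv]
    simp only [FunLike.coe_add, FunLike.coe_smul, Pi.add_apply, Pi.smul_apply,
      innerSL_apply_apply, real_inner_self_eq_norm_sq, he, one_pow, smul_eq_mul, mul_one,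
      Real.norm_eq_abs, sq_abs]
    ring
  have hφ : ContDiff ℝ 2 fun y => g (‖y - x₀‖ ^ 2) :=
    hg.comp ((contDiff_id.sub contDiff_const).norm_sq ℝ)
  rw [laplacian_eq_sum_fderiv_fderiv b hφ]
  simp only [hfst]
  rw [Finset.sum_congr rfl fun i _ => hsnd (b i) (b.norm_eq_one i), Finset.sum_add_distrib,
    Finset.sum_const, ← Finset.mul_sum, b.sum_sq_norm_inner_left, Finset.card_univ,
    Fintype.card_fin, nsmul_eq_mul]
  ring

end RadialLaplacian

section Cutoff

/-- A smooth nonincreasing cutoff, positive exactly on `(-∞, 1)`. Its rescalings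
`x ↦ cutoff (c ^ 2 * ‖x - x₀‖ ^ 2)` are the test functions for superharmonicity. -/
noncomputable def cutoff (t : ℝ) : ℝ := expNegInvGlue (1 - t)

/-- The negative of the derivative of `cutoff`, the radial profile of the averaging kernel; the junk
value of the inverse at `t = 1` is harmless since `expNegInvGlue 0 = 0`. -/
noncomputable def cutoffSlope (t : ℝ) : ℝ := ((1 - t)⁻¹) ^ 2 * expNegInvGlue (1 - t)

lemma cutoff_nonneg (t : ℝ) : 0 ≤ cutoff t := expNegInvGlue.nonneg _

lemma cutoff_eq_zero {t : ℝ} (ht : 1 ≤ t) : cutoff t = 0 :=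
  expNegInvGlue.zero_of_nonpos (sub_nonpos.2 ht)

lemma contDiff_cutoff : ContDiff ℝ ∞ cutoff :=
  expNegInvGlue.contDiff.comp (contDiff_const.sub contDiff_id)

lemma deriv_cutoff : deriv cutoff = -cutoffSlope := by
  funext t
  have h : HasDerivAt expNegInvGlue (((1 - t)⁻¹) ^ 2 * expNegInvGlue (1 - t)) (1 - t) := by
    simpa using expNegInvGlue.hasDerivAt_polynomial_eval_inv_mul 1 (1 - t)
  have hcutoff : HasDerivAt cutoff (-cutoffSlope t) t := h.comp_const_sub 1 t
  exact hcutoff.deriv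

lemma contDiff_cutoffSlope : ContDiff ℝ ∞ cutoffSlope := by
  rw [← neg_neg cutoffSlope, ← deriv_cutoff]
  exact (contDiff_infty_iff_deriv.1 contDiff_cutoff).2.neg

lemma cutoffSlope_nonneg (t : ℝ) : 0 ≤ cutoffSlope t :=
  mul_nonneg (sq_nonneg _) (expNegInvGlue.nonneg _)

lemma cutoffSlope_pos {t : ℝ} (ht : t < 1) : 0 < cutoffSlope t := by
  have ht' : 0 < 1 - t := sub_pos.2 ht
  exact mul_pos (by positivity) (expNegInvGlue.pos_of_pos ht')

lemma cutoffSlope_eq_zero {t : ℝ} (ht : 1 ≤ t) : cutoffSlope t = 0 := by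
  rw [cutoffSlope, expNegInvGlue.zero_of_nonpos (sub_nonpos.2 ht), mul_zero]

end Cutoff

section AveragingKernel

variable {E : Type*} [NormedAddCommGroup E] [InnerProductSpace ℝ E]

/-- The divergence of the vector field `x ↦ cutoffSlope (‖x‖ ^ 2) • x` in dimension `n`, as a
function of `t = ‖x‖ ^ 2`. -/
noncomputable def radialDivergence (n : ℕ) (t : ℝ) : ℝ :=
  n * cutoffSlope t + 2 * t * deriv cutoffSlope t

lemma continuous_radialDivergence (n : ℕ) : Continuous (radialDivergence n) := by
  have h : Continuous cutoffSlope := contDiff_cutoffSlope.continuous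
  have h' : Continuous (deriv cutoffSlope) := contDiff_cutoffSlope.continuous_deriv (by simp)
  unfold radialDivergence
  fun_prop

lemma radialDivergence_eq_zero (n : ℕ) {t : ℝ} (ht : 1 ≤ t) : radialDivergence n t = 0 := by
  have hmin : IsLocalMin cutoffSlope t := Eventually.of_forall fun s => by
    simpa only [cutoffSlope_eq_zero ht] using cutoffSlope_nonneg s
  rw [radialDivergence, cutoffSlope_eq_zero ht, hmin.deriv_eq_zero, mul_zero, mul_zero, add_zero]

lemma laplacian_cutoff [FiniteDimensional ℝ E] (c : ℝ) (x₀ x : E) :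
    Δ (fun y => cutoff (c ^ 2 * ‖y - x₀‖ ^ 2)) x
      = -(2 * c ^ 2) * radialDivergence (finrank ℝ E) (c ^ 2 * ‖x - x₀‖ ^ 2) := by
  have hg : ContDiff ℝ 2 fun t => cutoff (c ^ 2 * t) :=
    (contDiff_cutoff.of_le (by norm_cast)).comp (contDiff_const.mul contDiff_id)
  have hg1 : deriv (fun t => cutoff (c ^ 2 * t)) = fun t => -(c ^ 2 * cutoffSlope (c ^ 2 * t)) := by
    funext t
    rw [deriv_comp_mul_left, deriv_cutoff]
    simp
  have hg2 (t : ℝ) : deriv (fun t => -(c ^ 2 * cutoffSlope (c ^ 2 * t))) t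
      = -(c ^ 4 * deriv cutoffSlope (c ^ 2 * t)) := by
    rw [deriv.fun_neg, deriv_const_mul_field, deriv_comp_mul_left, smul_eq_mul]
    ring
  rw [laplacian_comp_norm_sub_sq hg, hg1, hg2, radialDivergence]
  ring

/-- The averaging kernel of width `1 / c`: a radial function of mass independent of `c`, supported
in the ball of radius `1 / c`. -/
noncomputable def averagingKernel (c : ℝ) (z : E) : ℝ :=
  c ^ finrank ℝ E * cutoffSlope (c ^ 2 * ‖z‖ ^ 2)

lemma continuous_averagingKernel (c : ℝ) : Continuous (averagingKernel c : E → ℝ) := by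
  have h : Continuous cutoffSlope := contDiff_cutoffSlope.continuous
  unfold averagingKernel
  fun_prop

lemma averagingKernel_nonneg {c : ℝ} (hc : 0 ≤ c) (z : E) : 0 ≤ averagingKernel c z :=
  mul_nonneg (pow_nonneg hc _) (cutoffSlope_nonneg _)

lemma averagingKernel_pos {c : ℝ} (hc : 0 < c) {z : E} (hz : c * ‖z‖ < 1) :
    0 < averagingKernel c z := by
  refine mul_pos (pow_pos hc _) (cutoffSlope_pos ?_)
  rw [← mul_pow]
  exact pow_lt_one₀ (by positivity) hz two_ne_zero

-- Up to a factor, the derivative in `c` is `-Δ` of the test function `cutoff (c ^ 2 * ‖z‖ ^ 2)`.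
lemma hasDerivAt_averagingKernel {c : ℝ} (hc : c ≠ 0) (z : E) :
    HasDerivAt (fun d => averagingKernel d z)
      (c ^ finrank ℝ E / c * radialDivergence (finrank ℝ E) (c ^ 2 * ‖z‖ ^ 2)) c := by
  have hpow : HasDerivAt (fun d : ℝ => d ^ finrank ℝ E) (finrank ℝ E * c ^ finrank ℝ E / c) c := by
    refine (hasDerivAt_pow (finrank ℝ E) c).congr_deriv ?_
    rcases Nat.eq_zero_or_pos (finrank ℝ E) with hn | hn
    · simp [hn]
    · rw [eq_div_iff hc, mul_assoc, pow_sub_one_mul hn.ne']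
  have harg : HasDerivAt (fun d : ℝ => d ^ 2 * ‖z‖ ^ 2) (2 * c * ‖z‖ ^ 2) c := by
    simpa using (hasDerivAt_pow 2 c).mul_const (‖z‖ ^ 2)
  have hslope : HasDerivAt cutoffSlope (deriv cutoffSlope (c ^ 2 * ‖z‖ ^ 2)) (c ^ 2 * ‖z‖ ^ 2) :=
    (contDiff_cutoffSlope.differentiable (by simp) _).hasDerivAt
  refine (hpow.mul (hslope.comp c harg)).congr_deriv ?_
  simp only [radialDivergence, Function.comp_apply]
  field_simp

end AveragingKernel

section StrongMinimum

lemma hasDerivAt_setIntegral_of_continuousOn {X : Type*} [TopologicalSpace X] [MeasurableSpace X]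
    [OpensMeasurableSpace X] [T2Space X] {ν : Measure X} [IsFiniteMeasureOnCompacts ν] {K : Set X}
    (hK : IsCompact K) {F F' : ℝ → X → ℝ} {s : Set ℝ} {c : ℝ} (hs : s ∈ 𝓝 c)
    (hF : ∀ d ∈ s, ContinuousOn (F d) K)
    (hF' : ContinuousOn (Function.uncurry F') (s ×ˢ K))
    (hFF' : ∀ d ∈ s, ∀ x ∈ K, HasDerivAt (fun d => F d x) (F' d x) d) :
    HasDerivAt (fun d => ∫ x in K, F d x ∂ν) (∫ x in K, F' c x ∂ν) c := by
  obtain ⟨ε, hε, hεs⟩ := Metric.nhds_basis_closedBall.mem_iff.1 hs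
  have hεs' : Metric.closedBall c ε ×ˢ K ⊆ s ×ˢ K := prod_mono_left hεs
  obtain ⟨C, hC⟩ := ((isCompact_closedBall c ε).prod hK).exists_bound_of_continuousOn
    (hF'.mono hεs')
  have hF'c : ContinuousOn (F' c) K :=
    hF'.comp (f := fun x => (c, x)) (by fun_prop) fun x hx => ⟨mem_of_mem_nhds hs, hx⟩
  refine (hasDerivAt_integral_of_dominated_loc_of_deriv_le (bound := fun _ => C)
    (Metric.closedBall_mem_nhds c hε) ?_ ((hF c (mem_of_mem_nhds hs)).integrableOn_compact hK)
    (hF'c.integrableOn_compact hK).aestronglyMeasurable ?_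
    (integrableOn_const hK.measure_lt_top.ne) ?_).2
  · filter_upwards [hs] with d hd
    exact ((hF d hd).integrableOn_compact hK).aestronglyMeasurable
  · exact ae_restrict_of_forall_mem hK.measurableSet fun x hx d hd => hC (d, x) ⟨hd, hx⟩
  · exact ae_restrict_of_forall_mem hK.measurableSet fun x hx d hd => hFF' d (hεs hd) x hx

variable {E : Type*} [NormedAddCommGroup E] [InnerProductSpace ℝ E] [FiniteDimensional ℝ E]
  [MeasurableSpace E] [BorelSpace E]

lemma integral_cutoffSlope_norm_sq_pos : 0 < ∫ z : E, cutoffSlope (‖z‖ ^ 2) := by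
  have hcont : Continuous fun z : E => cutoffSlope (‖z‖ ^ 2) :=
    contDiff_cutoffSlope.continuous.comp (by fun_prop)
  refine hcont.integral_pos_of_hasCompactSupport_nonneg_nonzero (x := 0)
    (HasCompactSupport.intro (isCompact_closedBall 0 1) fun z hz => cutoffSlope_eq_zero ?_)
    (fun z => cutoffSlope_nonneg _) (cutoffSlope_pos (by simp)).ne'
  rw [mem_closedBall_zero_iff, not_le] at hz
  exact one_le_pow₀ hz.le

/-- The integral of `w` over the closed ball of radius `r` around `x₀` against the averaging kernel
of width `1 / c`; it is an average of `w` up to normalization, once `1 ≤ c * r`. -/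
noncomputable def kernelAverage (w : E → ℝ) (x₀ : E) (r c : ℝ) : ℝ :=
  ∫ x in Metric.closedBall x₀ r, averagingKernel c (x - x₀) * w x

variable {Ω : Set E} {w : E → ℝ} {x₀ : E} {r : ℝ}

lemma hasDerivAt_kernelAverage (hw : ContinuousOn w (Metric.closedBall x₀ r)) {c : ℝ}
    (hc : 0 < c) :
    HasDerivAt (kernelAverage w x₀ r)
      (∫ x in Metric.closedBall x₀ r, c ^ finrank ℝ E / c
        * radialDivergence (finrank ℝ E) (c ^ 2 * ‖x - x₀‖ ^ 2) * w x) c := by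
  refine hasDerivAt_setIntegral_of_continuousOn (isCompact_closedBall x₀ r)
    (F := fun c x => averagingKernel c (x - x₀) * w x)
    (F' := fun c x => c ^ finrank ℝ E / c
        * radialDivergence (finrank ℝ E) (c ^ 2 * ‖x - x₀‖ ^ 2) * w x)
    (Ioi_mem_nhds hc) (fun d _ => ?_) ?_ fun d hd x _ => ?_
  · exact ((continuous_averagingKernel d).comp (by fun_prop)).continuousOn.mul hw
  · have hD := continuous_radialDivergence (finrank ℝ E)
    have hpow : ContinuousOn (fun p : ℝ × E => p.1 ^ finrank ℝ E / p.1)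
        (Ioi 0 ×ˢ Metric.closedBall x₀ r) :=
      ContinuousOn.div (by fun_prop) (by fun_prop) fun p hp => (mem_Ioi.1 hp.1).ne'
    exact (hpow.mul (by fun_prop)).mul (hw.comp continuousOn_snd fun p hp => hp.2)
  · exact (hasDerivAt_averagingKernel (mem_Ioi.1 hd).ne' (x - x₀)).mul_const (w x)

lemma IsWeaklySuperharmonicOn.setIntegral_radialDivergence_mul_nonneg (hΩ : IsOpen Ω)
    (h : IsWeaklySuperharmonicOn w Ω) (hr : Metric.closedBall x₀ r ⊆ Ω) {c : ℝ} (hc : 0 < c)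
    (hcr : 1 ≤ c * r) :
    0 ≤ ∫ x in Metric.closedBall x₀ r,
      radialDivergence (finrank ℝ E) (c ^ 2 * ‖x - x₀‖ ^ 2) * w x := by
  have hone {x : E} (hx : x ∉ Metric.closedBall x₀ r) : 1 ≤ c ^ 2 * ‖x - x₀‖ ^ 2 := by
    rw [Metric.mem_closedBall, dist_eq_norm, not_le] at hx
    rw [← mul_pow]
    exact one_le_pow₀ (hcr.trans (by gcongr))
  have hsmooth : ContDiff ℝ ∞ fun x => cutoff (c ^ 2 * ‖x - x₀‖ ^ 2) :=
    contDiff_cutoff.comp (contDiff_const.mul ((contDiff_id.sub contDiff_const).norm_sq ℝ))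
  have hsupp : tsupport (fun x => cutoff (c ^ 2 * ‖x - x₀‖ ^ 2)) ⊆ Metric.closedBall x₀ r :=
    closure_minimal (Function.support_subset_iff'.2 fun x hx => cutoff_eq_zero (hone hx))
      Metric.isClosed_closedBall
  have htest := h _ hsmooth ((isCompact_closedBall x₀ r).of_isClosed_subset
    (isClosed_tsupport _) hsupp) (hsupp.trans hr) fun x => cutoff_nonneg _
  rw [← setIntegral_eq_of_subset_of_forall_sdiff_eq_zero hΩ.measurableSet hr fun x hx => by
    rw [radialDivergence_eq_zero _ (hone hx.2), zero_mul]]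
  simp only [laplacian_cutoff, mul_left_comm (w _), integral_const_mul] at htest
  simpa only [mul_comm (w _)] using
    nonneg_of_mul_nonpos_right htest (neg_neg_of_pos (by positivity))

lemma IsWeaklySuperharmonicOn.monotoneOn_kernelAverage (hΩ : IsOpen Ω)
    (h : IsWeaklySuperharmonicOn w Ω) (hw : ContinuousOn w Ω) (hr0 : 0 < r)
    (hr : Metric.closedBall x₀ r ⊆ Ω) : MonotoneOn (kernelAverage w x₀ r) (Ici r⁻¹) := by
  have hd {c : ℝ} (hc : c ∈ Ici r⁻¹) := hasDerivAt_kernelAverage (hw.mono hr)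
    ((inv_pos.2 hr0).trans_le hc)
  refine monotoneOn_of_deriv_nonneg (convex_Ici _)
    (fun c hc => (hd hc).continuousAt.continuousWithinAt)
    (fun c hc => (hd (interior_subset hc)).differentiableAt.differentiableWithinAt) fun c hc => ?_
  have hc' : r⁻¹ ≤ c := interior_subset hc
  have hc0 : 0 < c := (inv_pos.2 hr0).trans_le hc'
  rw [(hd hc').deriv]
  simp only [mul_assoc, integral_const_mul]
  exact mul_nonneg (by positivity)
    (h.setIntegral_radialDivergence_mul_nonneg hΩ hr hc0 ((inv_le_iff_one_le_mul₀ hr0).1 hc'))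

lemma tendsto_kernelAverage (hr0 : 0 < r) (hw : ContinuousOn w (Metric.closedBall x₀ r)) :
    Tendsto (kernelAverage w x₀ r) atTop (𝓝 ((∫ z : E, cutoffSlope (‖z‖ ^ 2)) * w x₀)) := by
  have hM := integral_cutoffSlope_norm_sq_pos (E := E)
  set M := ∫ z : E, cutoffSlope (‖z‖ ^ 2)
  have hball : Metric.closedBall x₀ r ∈ 𝓝 x₀ := Metric.closedBall_mem_nhds x₀ hr0
  have hmeas := (Metric.isClosed_closedBall (x := x₀) (ε := r)).measurableSet
  have hdecay : Tendsto (fun z : E => ‖z‖ ^ finrank ℝ E * (M⁻¹ * cutoffSlope (‖z‖ ^ 2)))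
      (Bornology.cobounded E) (𝓝 0) := by
    refine tendsto_const_nhds.congr' ?_
    filter_upwards [tendsto_norm_cobounded_atTop.eventually_ge_atTop 1] with z hz
    rw [cutoffSlope_eq_zero (one_le_pow₀ hz), mul_zero, mul_zero]
  have hlim := (tendsto_integral_comp_smul_smul_of_integrable' (μ := volume)
    (φ := fun z : E => M⁻¹ * cutoffSlope (‖z‖ ^ 2))
    (fun z => mul_nonneg (inv_nonneg.2 hM.le) (cutoffSlope_nonneg _))
    (by rw [integral_const_mul, inv_mul_cancel₀ hM.ne']) hdecay
    ((integrable_indicator_iff hmeas).2 (hw.integrableOn_compact (isCompact_closedBall x₀ r)))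
    ((hw.continuousAt hball).congr (eqOn_indicator.eventuallyEq_of_mem hball).symm)).const_mul M
  rw [indicator_of_mem (mem_of_mem_nhds hball)] at hlim
  refine hlim.congr fun c => ?_
  rw [kernelAverage, ← integral_indicator hmeas, ← integral_const_mul]
  refine integral_congr_ae (Eventually.of_forall fun x => ?_)
  by_cases hx : x ∈ Metric.closedBall x₀ r
  · simp only [indicator_of_mem hx, averagingKernel, norm_smul, mul_pow, norm_sub_rev x₀,
      Real.norm_eq_abs, sq_abs, smul_eq_mul]
    field_simp
  · simp only [indicator_of_notMem hx, smul_zero, mul_zero]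

lemma IsWeaklySuperharmonicOn.kernelAverage_le (hΩ : IsOpen Ω)
    (h : IsWeaklySuperharmonicOn w Ω) (hw : ContinuousOn w Ω) (hr0 : 0 < r)
    (hr : Metric.closedBall x₀ r ⊆ Ω) :
    kernelAverage w x₀ r r⁻¹ ≤ (∫ z : E, cutoffSlope (‖z‖ ^ 2)) * w x₀ :=
  ge_of_tendsto (tendsto_kernelAverage hr0 (hw.mono hr)) <|
    (eventually_ge_atTop r⁻¹).mono fun _ hc =>
      h.monotoneOn_kernelAverage hΩ hw hr0 hr self_mem_Ici hc hc

lemma IsWeaklySuperharmonicOn.eqOn_ball_zero (hΩ : IsOpen Ω) (h : IsWeaklySuperharmonicOn w Ω)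
    (hw : ContinuousOn w Ω) (hw0 : ∀ x ∈ Ω, 0 ≤ w x) (hr0 : 0 < r)
    (hr : Metric.closedBall x₀ r ⊆ Ω) (hwx₀ : w x₀ = 0) : EqOn w 0 (Metric.ball x₀ r) := by
  have hball : Metric.ball x₀ r ⊆ Metric.closedBall x₀ r := Metric.ball_subset_closedBall
  have hmeas := (Metric.isClosed_closedBall (x := x₀) (ε := r)).measurableSet
  have hcont : ContinuousOn (fun x => averagingKernel r⁻¹ (x - x₀) * w x)
      (Metric.closedBall x₀ r) :=
    ((continuous_averagingKernel r⁻¹).comp (by fun_prop)).continuousOn.mul (hw.mono hr)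
  have hnonneg : ∀ x ∈ Metric.closedBall x₀ r, 0 ≤ averagingKernel r⁻¹ (x - x₀) * w x :=
    fun x hx => mul_nonneg (averagingKernel_nonneg (by positivity) _) (hw0 x (hr hx))
  have hzero : kernelAverage w x₀ r r⁻¹ = 0 :=
    le_antisymm (by simpa [hwx₀] using h.kernelAverage_le hΩ hw hr0 hr)
      (setIntegral_nonneg hmeas hnonneg)
  have hae := (setIntegral_eq_zero_iff_of_nonneg_ae (ae_restrict_of_forall_mem hmeas hnonneg)
    (hcont.integrableOn_compact (isCompact_closedBall x₀ r))).1 hzero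
  have hprod := Measure.eqOn_open_of_ae_eq (ae_restrict_of_ae_restrict_of_subset hball hae)
    Metric.isOpen_ball (hcont.mono hball) continuousOn_const
  intro x hx
  refine (mul_eq_zero.1 (hprod hx)).resolve_left (averagingKernel_pos (by positivity) ?_).ne'
  rwa [inv_mul_lt_one₀ hr0, ← dist_eq_norm]

theorem IsWeaklySuperharmonicOn.eq_zero_or_pos (hΩ : IsOpen Ω) (hconn : IsPreconnected Ω)
    (h : IsWeaklySuperharmonicOn w Ω) (hw : ContinuousOn w Ω) (hw0 : ∀ x ∈ Ω, 0 ≤ w x) :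
    (∀ x ∈ Ω, w x = 0) ∨ ∀ x ∈ Ω, 0 < w x := by
  by_cases hz : ∃ x ∈ Ω, w x = 0
  · left
    obtain ⟨x₀, hx₀, hwx₀⟩ := hz
    have hzeros : IsOpen {x ∈ Ω | w x = 0} := Metric.isOpen_iff.2 fun x hx => by
      obtain ⟨r, hr0, hr⟩ := Metric.nhds_basis_closedBall.mem_iff.1 (hΩ.mem_nhds hx.1)
      exact ⟨r, hr0, fun y hy => ⟨hr (Metric.ball_subset_closedBall hy),
        h.eqOn_ball_zero hΩ hw hw0 hr0 hr hx.2 hy⟩⟩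
    have hpos : IsOpen {x ∈ Ω | 0 < w x} := hw.isOpen_inter_preimage hΩ isOpen_Ioi
    have hsub : Ω ⊆ {x ∈ Ω | w x = 0} := hconn.subset_left_of_subset_union hzeros hpos
      (disjoint_left.2 fun x hx hx' => hx'.2.ne' hx.2)
      (fun x hx => (hw0 x hx).eq_or_lt.imp (fun e => ⟨hx, e.symm⟩) fun e => ⟨hx, e⟩)
      ⟨x₀, hx₀, hx₀, hwx₀⟩
    exact fun x hx => (hsub hx).2
  · right
    push Not at hz
    exact fun x hx => (hw0 x hx).lt_of_ne' (hz x hx)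

end StrongMinimum

end Hartree

theorem theorem4p1_general (N : ℕ) [NeZero N] (μ : ℝ) (hμ : 0 ≤ μ) (f : ℝ → ℝ) (hf0 : f 0 = 0)
    (hfm : MonotoneOn f (Set.Ici 0) ∨ AntitoneOn f (Set.Ici 0))
    (Γ : Set (EuclideanSpace ℝ (Fin N))) (hΓ : IsClosed Γ) (hΓ0 : volume Γ = 0)
    (lam : ℝ) (hconn : IsPreconnected (Hartree.puncturedHalfSpace lam Γ))
    (u : EuclideanSpace ℝ (Fin N) → ℝ) (hu0 : ∀ x ∉ Γ, 0 ≤ u x)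
    (huc : ContinuousOn u (Hartree.puncturedHalfSpace lam Γ))
    (hulc : ContinuousOn (Hartree.reflected lam u) (Hartree.puncturedHalfSpace lam Γ))
    (hsuper : Hartree.IsWeakSupersolution μ f (Hartree.reflection lam '' Γ)
      (Hartree.puncturedHalfSpace lam Γ) (Hartree.reflected lam u))
    (hsub : Hartree.IsWeakSubsolution μ f Γ (Hartree.puncturedHalfSpace lam Γ) u)
    (hle : ∀ x ∈ Hartree.puncturedHalfSpace lam Γ, u x ≤ Hartree.reflected lam u x) :
    (∀ x ∈ Hartree.puncturedHalfSpace lam Γ, u x = Hartree.reflected lam u x) ∨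
      (∀ x ∈ Hartree.puncturedHalfSpace lam Γ, u x < Hartree.reflected lam u x) := by
  have hΩ := Hartree.isOpen_puncturedHalfSpace (lam := lam) hΓ
  have hrhs : ∀ᵐ x ∂volume.restrict (Hartree.puncturedHalfSpace lam Γ),
      Hartree.potential μ f Γ u x * f (u x) ≤
        Hartree.potential μ f (Hartree.reflection lam '' Γ) (Hartree.reflected lam u) x *
          f (Hartree.reflected lam u x) := by
    obtain ⟨_, hul, _⟩ := id hsuper
    obtain ⟨_, hu, _⟩ := id hsub
    filter_upwards [hu.integrable_potential, hul.integrable_potential,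
      ae_restrict_mem hΩ.measurableSet,
      ae_restrict_of_ae (measure_eq_zero_iff_ae_notMem.1 hΓ0)] with x hux hulx hx hxΓ
    exact Hartree.rhs_le_rhs_reflected hμ hf0 hfm hΓ0 hu0 hle hx hxΓ hux hulx
  have hsuperharmonic := Hartree.isWeaklySuperharmonicOn_sub hΩ hsuper hsub hrhs
  refine (hsuperharmonic.eq_zero_or_pos hΩ hconn (hulc.sub huc) fun x hx =>
    sub_nonneg.2 (hle x hx)).imp (fun h x hx => ?_) fun h x hx => ?_
  · exact (sub_eq_zero.1 (h x hx)).symm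
  · exact sub_pos.1 (h x hx)

theorem theorem4p1 (N : ℕ) [NeZero N] (μ : ℝ) (hμ : 0 < μ) (hμN : μ < N)
    (f : ℝ → ℝ) (hfc : ContinuousOn f (Set.Ici 0)) (hf0 : f 0 = 0)
    (hfm : MonotoneOn f (Set.Ici 0) ∨ AntitoneOn f (Set.Ici 0))
    (Γ : Set (EuclideanSpace ℝ (Fin N))) (hΓ : IsCompact Γ) (hΓ0 : ∀ x ∈ Γ, x 0 = 0)
    (lam : ℝ) (hconn : IsConnected (Hartree.puncturedHalfSpace lam Γ))
    (u : EuclideanSpace ℝ (Fin N) → ℝ) (hu0 : ∀ x ∉ Γ, 0 ≤ u x)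
    (huc : ContinuousOn u (Hartree.puncturedHalfSpace lam Γ))
    (hulc : ContinuousOn (Hartree.reflected lam u) (Hartree.puncturedHalfSpace lam Γ))
    (hsuper : Hartree.IsWeakSupersolution μ f (Hartree.reflection lam '' Γ)
      (Hartree.puncturedHalfSpace lam Γ) (Hartree.reflected lam u))
    (hsub : Hartree.IsWeakSubsolution μ f Γ (Hartree.puncturedHalfSpace lam Γ) u)
    (hle : ∀ x ∈ Hartree.puncturedHalfSpace lam Γ, u x ≤ Hartree.reflected lam u x) :
    (∀ x ∈ Hartree.puncturedHalfSpace lam Γ, u x = Hartree.reflected lam u x) ∨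
      (∀ x ∈ Hartree.puncturedHalfSpace lam Γ, u x < Hartree.reflected lam u x) :=
  theorem4p1_general N μ hμ.le f hf0 hfm Γ hΓ.isClosed
    (Hartree.volume_eq_zero_of_forall_apply_zero_eq_zero hΓ0) lam hconn.isPreconnected u hu0 huc
    hulc hsuper hsub hle
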